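/- Conventions. For $\mathbf x\in\mathbb R^n$ let $x_{(1)}\le\dots\le x_{(n)}$ be the increasing arrangement of its components. Write $\mathbf y\succeq_{\rm m}\mathbf x$ (majorization) if $\sum_{i=1}^n x_{(i)}=\sum_{i=1}^n y_{(i)}$ and $\sum_{i=1}^j x_{(i)}\ge\sum_{i=1}^j y_{(i)}$ for $j=1,\dots,n-1$; $\mathbf y\succeq^{\rm w}\mathbf x$ (supmajorization) if $\sum_{i=1}^j x_{(i)}\ge\sum_{i=1}^j y_{(i)}$ for $j=1,\dots,n$; and $\mathbf y\succeq_{\rm w}\mathbf x$ (submajorization) if $\sum_{i=j}^n x_{(i)}\le\sum_{i=j}^n y_{(i)}$ for $j=1,\dots,n$. For random variables, $X\ge_{\rm st}Y$ means $P(X\le t)\le P(Y\le t)$ for all $t\in\mathbb R$. If $X$ and $Y$ have densities, $X\ge_{\rm lr}Y$ means that, for suitable versions $f_X,f_Y$ of the densities, the ratio $f_X/f_Y\in[0,\infty]$ is increasing on the set where it is not of the form $0/0$ (here $c/0=\infty$ for $c>0$). A density $f$ on $\mathbb R$ is log-concave if $f(\alpha x+(1-\alpha)y)\ge f(x)^\alpha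 f(y)^{1-\alpha}$ for all $x,y\in\mathbb R$, $\alpha\in[0,1]$. Theorem. Let $I,J\subseteq\mathbb R$ be intervals with nonempty interior (for example $[0,\infty)$, $(0,\infty)$ or $\mathbb R$), and let $\varphi:I\to[0,\infty)$ and $\psi:J\to[0,\infty)$ be twice continuously differentiable (one-sidedly at any endpoint that belongs to the interval) and strictly monotone, such that for all $(u,v)\in I\times J$ $$\varphi''(u)\ge 0\qquad\text{and}\qquad \varphi''(u)\,\psi''(v)\,\varphi(u)\,\psi(v)\ge[\varphi'(u)\,\psi'(v)]^2 .$$ Let $X_1,\dots,X_n$ be independent nonnegative random variables with $X_1\ge_{\rm lr}X_2\ge_{\rm lr}\cdots\ge_{\rm lr}X_n$, such that for each $i$ one has $X_i\in\psi(J)$ almost surely and $\psi^{-1}(X_i)$ has a log-concave density. Let $a_1,\dots,a_n,b_1,\dots,b_n\in\varphi(I)$. If $$(\varphi^{-1}(a_1),\dots,\varphi^{-1}(a_n))\succeq_{\rm m}(\varphi^{-1}(b_1),\dots,\varphi^{-1}(b_n)),$$ then $$\sum_{i=1}^n a_{(n-i+1)}X_i\ \ge_{\rm st}\ \sum_{i=1}^n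 b_{(n-i+1)}X_i .$$ Moreover, if $\varphi$ is increasing, the same conclusion holds with $\succeq_{\rm m}$ replaced by submajorization $\succeq_{\rm w}$ in the hypothesis; if $\varphi$ is decreasing, it holds with $\succeq_{\rm m}$ replaced by supmajorization $\succeq^{\rm w}$. -/

import Mathlib

open MeasureTheory ProbabilityTheory
open scoped NNReal ENNReal

/-- The increasing arrangement `x_(1) ≤ x_(2) ≤ ... ≤ x_(n)` of the components of a vector;
index `i : Fin n` stands for the subscript `i + 1`. -/
noncomputable def increasingArrangement {n : ℕ} (x : Fin n → ℝ) : Fin n → ℝ :=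
  x ∘ Tuple.sort x

/-- `Majorizes y x` means `y ⪰_m x`: the vector `x` is majorized by `y`.
The inequality for the full sum follows from the equality of the sums. -/
def Majorizes {n : ℕ} (y x : Fin n → ℝ) : Prop :=
  ∑ i, increasingArrangement x i = ∑ i, increasingArrangement y i ∧
    ∀ j : Fin n, ∑ i ∈ Finset.Iic j, increasingArrangement y i
      ≤ ∑ i ∈ Finset.Iic j, increasingArrangement x i

/-- `SupMajorizes y x` means `y ⪰^w x`: the vector `x` is weakly supmajorized by `y`
(sums of the smallest components). -/
def SupMajorizes {n : ℕ} (y x : Fin n → ℝ) : Prop :=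
  ∀ j : Fin n, ∑ i ∈ Finset.Iic j, increasingArrangement y i
    ≤ ∑ i ∈ Finset.Iic j, increasingArrangement x i

/-- `SubMajorizes y x` means `y ⪰_w x`: the vector `x` is weakly submajorized by `y`
(sums of the largest components). -/
def SubMajorizes {n : ℕ} (y x : Fin n → ℝ) : Prop :=
  ∀ j : Fin n, ∑ i ∈ Finset.Ici j, increasingArrangement x i
    ≤ ∑ i ∈ Finset.Ici j, increasingArrangement y i

/-- A function on a convex set `A` is log-concave if
`h (α x + (1 - α) y) ≥ h(x)^α h(y)^(1-α)` for `x, y ∈ A` and `α ∈ [0, 1]`. -/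
def IsLogConcaveOn {E : Type*} [AddCommGroup E] [Module ℝ E] (A : Set E) (h : E → ℝ) : Prop :=
  Convex ℝ A ∧ ∀ x ∈ A, ∀ y ∈ A, ∀ α ∈ Set.Icc (0 : ℝ) 1,
    h x ^ α * h y ^ (1 - α) ≤ h (α • x + (1 - α) • y)

section RandomVariables

variable {Ω : Type*} [MeasurableSpace Ω]

/-- `f` is a (version of the) probability density function of `X` with respect to Lebesgue
measure. -/
def IsDensityOf (f : ℝ → ℝ≥0) (X : Ω → ℝ) (μ : Measure Ω) : Prop :=
  AEMeasurable X μ ∧ Measurable f ∧ μ.map X = volume.withDensity (fun x => (f x : ℝ≥0∞))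

/-- `X` has a log-concave density function on the line. -/
def HasLogConcaveDensity (X : Ω → ℝ) (μ : Measure Ω) : Prop :=
  ∃ f : ℝ → ℝ≥0, IsDensityOf f X μ ∧ IsLogConcaveOn Set.univ (fun x => (f x : ℝ))

/-- `X ≤_st Y`, the usual stochastic order: the distribution function of `X` is everywhere at
least that of `Y`. -/
def StochasticLE (X Y : Ω → ℝ) (μ : Measure Ω) : Prop :=
  ∀ t : ℝ, μ {ω | Y ω ≤ t} ≤ μ {ω | X ω ≤ t}

/-- `X ≤_lr Y`, the likelihood ratio order: for (versions of) the densities `f` of `X` and `g`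
of `Y`, the ratio `g / f`, with values in `[0, ∞]` (so `c / 0 = ∞` for `c > 0`), is increasing on
the set where it is well defined, that is, not of the form `0 / 0`. -/
def LikelihoodRatioLE (X Y : Ω → ℝ) (μ : Measure Ω) : Prop :=
  ∃ f g : ℝ → ℝ≥0, IsDensityOf f X μ ∧ IsDensityOf g Y μ ∧
    MonotoneOn (fun x => (g x : ℝ≥0∞) / (f x : ℝ≥0∞)) {x | ¬(g x = 0 ∧ f x = 0)}

end RandomVariables

/-! Fix `t` and consider `u ↦ P(∑ φ(u_i) X_i ≤ t)` on `I^n`. Its superlevel sets are convex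
(`convex_setOf_le_measure_sum_mul_le`): with `X_i = ψ(V_i)`, the probability is the integral of a
log-concave product density over `{v | ∑ φ(u_i) ψ(v_i) ≤ t}`. The differential inequality makes
`φ(u) ψ(v)` jointly convex (`convexOn_mul_of_deriv`), so these sets combine convexly as `u` varies,
and `prekopa_leindler` applies.

By the likelihood ratio order, among all rearrangements of the coefficients `a` the decreasing one
minimises the probability (`withDensity_prod_swap_le`, `antitone_le_comp_perm`). So the superlevel
set at that minimum contains every permutation of `φ⁻¹(a)`, hence their convex hull. Majorization
places `φ⁻¹(b)` in this hull; weak majorization places it below or above a point of the hull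
(`SupMajorizes.exists_le`), and monotonicity of `φ` with `X_i ≥ 0` closes the gap. -/

/-! ### Brunn–Minkowski and Prékopa–Leindler on the line. -/

/-- One-dimensional Brunn–Minkowski inequality for compact sets. -/
theorem volume_add_volume_le_of_isCompact {K L C : Set ℝ} (hK : IsCompact K) (hL : IsCompact L)
    (hK0 : K.Nonempty) (hL0 : L.Nonempty) (hC : ∀ x ∈ K, ∀ y ∈ L, x + y ∈ C) :
    volume K + volume L ≤ volume C := by
  -- With `k = max K` and `l = min L`, the translates `K + l` and `k + L` both lie in `C` and meet
  -- only at `k + l`.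
  obtain ⟨k, hk, hkub⟩ := hK.exists_isGreatest hK0
  obtain ⟨l, hl, hllb⟩ := hL.exists_isLeast hL0
  have h1 : volume ((fun x => x + l) '' K) = volume K := by
    rw [Set.image_add_right]; exact measure_preimage_add_right _ _ _
  have h2 : volume ((fun y => k + y) '' L) = volume L := by
    rw [Set.image_add_left]; exact measure_preimage_add _ _ _
  have hd : AEDisjoint volume ((fun x => x + l) '' K) ((fun y => k + y) '' L) := by
    refine measure_mono_null (t := {k + l}) ?_ (by simp)
    rintro z ⟨⟨x, hx, rfl⟩, ⟨y, hy, hxy⟩⟩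
    have a1 := hkub hx
    have a2 := hllb hy
    simp only [Set.mem_singleton_iff] at *
    linarith
  have hm : NullMeasurableSet ((fun y => k + y) '' L) volume :=
    (hL.image (by fun_prop)).measurableSet.nullMeasurableSet
  rw [← h1, ← h2, ← measure_union₀ hm hd]
  apply measure_mono
  rintro z (⟨x, hx, rfl⟩ | ⟨y, hy, rfl⟩)
  · exact hC _ hx _ hl
  · exact hC _ hk _ hy

/-- One-dimensional Brunn–Minkowski inequality. -/
theorem volume_add_volume_le {A B C : Set ℝ} (hA : MeasurableSet A) (hB : MeasurableSet B)
    (hA0 : A.Nonempty) (hB0 : B.Nonempty) (hC : ∀ x ∈ A, ∀ y ∈ B, x + y ∈ C) :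
    volume A + volume B ≤ volume C := by
  obtain ⟨a, ha⟩ := hA0
  obtain ⟨b, hb⟩ := hB0
  rw [hA.measure_eq_iSup_isCompact, hB.measure_eq_iSup_isCompact]
  simp only [iSup_and']
  have key : ∀ K, K ⊆ A ∧ IsCompact K → ∀ L, L ⊆ B ∧ IsCompact L →
      volume K + volume L ≤ volume C := by
    intro K ⟨hKA, hK⟩ L ⟨hLB, hL⟩
    -- An approximating compact set may be empty; inserting a point of `A` or `B` repairs this.
    calc volume K + volume L ≤ volume (insert a K) + volume (insert b L) := by
          gcongr <;> exact Set.subset_insert _ _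
      _ ≤ volume C := by
          refine volume_add_volume_le_of_isCompact (hK.insert a) (hL.insert b)
            (Set.insert_nonempty _ _) (Set.insert_nonempty _ _) ?_
          intro x hx y hy
          exact hC x (Set.insert_subset ha hKA hx) y (Set.insert_subset hb hLB hy)
  refine ENNReal.biSup_add_biSup_le' (p := fun K => K ⊆ A ∧ IsCompact K)
    (q := fun K => K ⊆ B ∧ IsCompact K) ⟨∅, by simp⟩ ⟨∅, by simp⟩ key

/-- Weighted one-dimensional Brunn–Minkowski inequality. -/
theorem volume_weighted_add_le {A B C : Set ℝ} (hA : MeasurableSet A) (hB : MeasurableSet B)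
    (hA0 : A.Nonempty) (hB0 : B.Nonempty) {p q : ℝ} (hp : 0 < p) (hq : 0 < q)
    (hC : ∀ x ∈ A, ∀ y ∈ B, p * x + q * y ∈ C) :
    ENNReal.ofReal p * volume A + ENNReal.ofReal q * volume B ≤ volume C := by
  have hs : ∀ (r : ℝ) (hr : 0 < r) (D : Set ℝ), 
      volume ((fun x => r⁻¹ * x) ⁻¹' D) = ENNReal.ofReal r * volume D := by
    intro r hr D
    rw [Real.volume_preimage_mul_left (inv_ne_zero hr.ne'), inv_inv, abs_of_pos hr]
  rw [← hs p hp, ← hs q hq]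
  have hmem : ∀ (r : ℝ) (hr : 0 < r) (D : Set ℝ), D.Nonempty →
      ((fun x => r⁻¹ * x) ⁻¹' D).Nonempty := by
    rintro r hr D ⟨d, hd⟩
    exact ⟨r * d, by simpa [← mul_assoc, inv_mul_cancel₀ hr.ne'] using hd⟩
  refine volume_add_volume_le (hA.preimage (by fun_prop)) (hB.preimage (by fun_prop))
    (hmem p hp A hA0) (hmem q hq B hB0) ?_
  intro x hx y hy
  have := hC _ hx _ hy
  rwa [← mul_assoc, ← mul_assoc, mul_inv_cancel₀ hp.ne', mul_inv_cancel₀ hq.ne', one_mul,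
    one_mul] at this

theorem ENNReal.geom_mean_le_arith_mean {p q : ℝ} (hp : 0 < p) (hq : 0 < q) (hpq : p + q = 1)
    (x y : ℝ≥0∞) :
    x ^ p * y ^ q ≤ ENNReal.ofReal p * x + ENNReal.ofReal q * y := by
  by_cases hx : x = ∞
  · simp [hx, ENNReal.mul_top, hp]
  by_cases hy : y = ∞
  · simp [hy, ENNReal.mul_top, hq]
  lift x to ℝ≥0 using hx
  lift y to ℝ≥0 using hy
  lift p to ℝ≥0 using hp.le
  lift q to ℝ≥0 using hq.le
  rw [← ENNReal.coe_rpow_of_nonneg x p.coe_nonneg, ← ENNReal.coe_rpow_of_nonneg y q.coe_nonneg,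
    ENNReal.ofReal_coe_nnreal, ENNReal.ofReal_coe_nnreal]
  exact_mod_cast NNReal.geom_mean_le_arith_mean2_weighted p q x y (by exact_mod_cast hpq)

/-- Prékopa–Leindler with arithmetic means, for functions with values in `[0, 1]` and
supremum `1`. -/
theorem lintegral_weighted_add_le {f g h : ℝ → ℝ} (hf : Measurable f) (hg : Measurable g)
    (hh : Measurable h) (hf0 : ∀ x, 0 ≤ f x) (hg0 : ∀ x, 0 ≤ g x) (hh0 : ∀ x, 0 ≤ h x)
    (hf1 : ∀ x, f x ≤ 1) (hg1 : ∀ x, g x ≤ 1) (hfs : ∀ t < 1, ∃ x, t < f x)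
    (hgs : ∀ t < 1, ∃ x, t < g x) {p q : ℝ} (hp : 0 < p) (hq : 0 < q)
    (H : ∀ t, 0 < t → ∀ x y, t < f x → t < g y → t < h (p * x + q * y)) :
    ENNReal.ofReal p * (∫⁻ x, ENNReal.ofReal (f x)) +
        ENNReal.ofReal q * (∫⁻ x, ENNReal.ofReal (g x))
      ≤ ∫⁻ x, ENNReal.ofReal (h x) := by
  rw [lintegral_eq_lintegral_meas_lt _ (.of_forall hf0) hf.aemeasurable,
    lintegral_eq_lintegral_meas_lt _ (.of_forall hg0) hg.aemeasurable,
    lintegral_eq_lintegral_meas_lt _ (.of_forall hh0) hh.aemeasurable]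
  have hm : ∀ k : ℝ → ℝ, Measurable fun t => volume {a | t < k a} := fun k =>
    Antitone.measurable fun s t hst => measure_mono fun a ha => lt_of_le_of_lt hst ha
  rw [← lintegral_const_mul _ (hm f), ← lintegral_const_mul _ (hm g),
    ← lintegral_add_left ((hm f).const_mul _)]
  refine setLIntegral_mono (hm h) fun t ht => ?_
  -- Brunn–Minkowski needs nonempty sets: below level 1 both superlevel sets are nonempty, from
  -- level 1 on both are empty.
  rcases lt_or_ge t 1 with h1 | h1
  · exact volume_weighted_add_le (measurableSet_lt measurable_const hf)
      (measurableSet_lt measurable_const hg) (hfs t h1) (hgs t h1) hp hq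
      fun x hx y hy => H t ht x y hx hy
  · have e1 : {a | t < f a} = ∅ := by ext a; simpa using (hf1 a).trans h1
    have e2 : {a | t < g a} = ∅ := by ext a; simpa using (hg1 a).trans h1
    simp [e1, e2]

/-- Prékopa–Leindler on the line for bounded functions. -/
theorem prekopa_leindler_bounded {f g h : ℝ → ℝ≥0∞} (hf : Measurable f) (hg : Measurable g)
    (hh : Measurable h) (hfb : ⨆ x, f x ≠ ∞) (hgb : ⨆ x, g x ≠ ∞)
    {p q : ℝ} (hp : 0 < p) (hq : 0 < q) (hpq : p + q = 1)
    (H : ∀ x y, f x ^ p * g y ^ q ≤ h (p * x + q * y)) :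
    (∫⁻ x, f x) ^ p * (∫⁻ x, g x) ^ q ≤ ∫⁻ x, h x := by
  set M := ⨆ x, f x with hM
  set N := ⨆ x, g x with hN
  have hfM : ∀ x, f x ≤ M := le_iSup f
  have hgN : ∀ x, g x ≤ N := le_iSup g
  rcases eq_or_ne M 0 with hM0 | hM0
  · have : ∀ x, f x = 0 := fun x => le_antisymm (hM0 ▸ hfM x) zero_le
    simp [this, hp]
  rcases eq_or_ne N 0 with hN0 | hN0
  · have : ∀ x, g x = 0 := fun x => le_antisymm (hN0 ▸ hgN x) zero_le
    simp [this, hq]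
  have hc0 : M ^ p * N ^ q ≠ 0 := by
    simp [hM0, hN0, hfb, hgb, ENNReal.rpow_eq_zero_iff]
  have hct : M ^ p * N ^ q ≠ ∞ := ENNReal.mul_ne_top
    (ENNReal.rpow_ne_top_of_nonneg hp.le hfb) (ENNReal.rpow_ne_top_of_nonneg hq.le hgb)
  have hf1 : ∀ x, f x / M ≤ 1 := fun x => ENNReal.div_le_of_le_mul (by simpa using hfM x)
  have hg1 : ∀ x, g x / N ≤ 1 := fun x => ENNReal.div_le_of_le_mul (by simpa using hgN x)
  have hft : ∀ x, f x / M ≠ ∞ := fun x => ((hf1 x).trans_lt ENNReal.one_lt_top).ne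
  have hgt : ∀ x, g x / N ≠ ∞ := fun x => ((hg1 x).trans_lt ENNReal.one_lt_top).ne
  have hht : ∀ x, min 1 (h x / (M ^ p * N ^ q)) ≠ ∞ := fun x =>
    ((min_le_left _ _).trans_lt ENNReal.one_lt_top).ne
  have hsup : ∀ (k : ℝ → ℝ≥0∞), ⨆ x, k x ≠ 0 → ⨆ x, k x ≠ ∞ → ∀ t < (1 : ℝ),
      ∃ x, t < (k x / ⨆ x, k x).toReal := by
    intro k h0 ht t ht1
    rcases lt_or_ge t 0 with h | h
    · exact ⟨0, h.trans_le ENNReal.toReal_nonneg⟩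
    have : ENNReal.ofReal t * (⨆ x, k x) < ⨆ x, k x := by
      conv_rhs => rw [← one_mul (⨆ x, k x)]
      exact ENNReal.mul_lt_mul_left h0 ht (by simpa using ht1)
    obtain ⟨x, hx⟩ := lt_iSup_iff.1 this
    refine ⟨x, (ENNReal.ofReal_lt_iff_lt_toReal h ?_).1 ?_⟩
    · exact ENNReal.div_ne_top (((le_iSup k x).trans_lt ht.lt_top).ne) h0
    · rwa [ENNReal.lt_div_iff_mul_lt (.inl h0) (.inl ht)]
  -- Dividing by the suprema makes both superlevel sets nonempty at the same levels. Capping `h` at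
  -- 1 keeps it finite and is harmless, since only levels below 1 occur.
  have main := lintegral_weighted_add_le (f := fun x => (f x / M).toReal)
    (g := fun x => (g x / N).toReal)
    (h := fun x => (min 1 (h x / (M ^ p * N ^ q))).toReal)
    (by fun_prop) (by fun_prop) (by fun_prop) (fun _ => ENNReal.toReal_nonneg)
    (fun _ => ENNReal.toReal_nonneg) (fun _ => ENNReal.toReal_nonneg)
    (fun x => ENNReal.toReal_le_of_le_ofReal zero_le_one (by simpa using hf1 x))
    (fun x => ENNReal.toReal_le_of_le_ofReal zero_le_one (by simpa using hg1 x))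
    (hsup f hM0 hfb) (hsup g hN0 hgb) hp hq (by
      intro t ht x y hx hy
      rw [← ENNReal.ofReal_lt_iff_lt_toReal ht.le (hft x)] at hx
      rw [← ENNReal.ofReal_lt_iff_lt_toReal ht.le (hgt y)] at hy
      rw [← ENNReal.ofReal_lt_iff_lt_toReal ht.le (hht _), lt_min_iff]
      refine ⟨hx.trans_le (hf1 x), ?_⟩
      calc ENNReal.ofReal t = ENNReal.ofReal t ^ p * ENNReal.ofReal t ^ q := by
            rw [← ENNReal.rpow_add _ _ (by simpa using ht) (by simp), hpq, ENNReal.rpow_one]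
        _ < (f x / M) ^ p * (g y / N) ^ q :=
            ENNReal.mul_lt_mul (ENNReal.rpow_lt_rpow hx hp) (ENNReal.rpow_lt_rpow hy hq)
        _ = f x ^ p * g y ^ q / (M ^ p * N ^ q) := by
            rw [ENNReal.div_rpow_of_nonneg _ _ hp.le, ENNReal.div_rpow_of_nonneg _ _ hq.le,
              ENNReal.mul_div_mul_comm (.inl ?_) (.inl ?_)]
            · simp [hM0, hfb]
            · exact ENNReal.rpow_ne_top_of_nonneg hp.le hfb
        _ ≤ _ := by gcongr; exact H x y)
  simp only [ENNReal.ofReal_toReal (hft _), ENNReal.ofReal_toReal (hgt _),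
    ENNReal.ofReal_toReal (hht _)] at main
  have main2 : (∫⁻ x, f x / M) ^ p * (∫⁻ x, g x / N) ^ q ≤ ∫⁻ x, h x / (M ^ p * N ^ q) :=
    (ENNReal.geom_mean_le_arith_mean hp hq hpq _ _).trans
      (main.trans (lintegral_mono fun x => min_le_right _ _))
  simp only [div_eq_mul_inv] at main2
  rw [lintegral_mul_const _ hf, lintegral_mul_const _ hg, lintegral_mul_const _ hh,
    ← div_eq_mul_inv, ← div_eq_mul_inv, ← div_eq_mul_inv,
    ENNReal.div_rpow_of_nonneg _ _ hp.le, ENNReal.div_rpow_of_nonneg _ _ hq.le,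
    ← ENNReal.mul_div_mul_comm (.inl ?_) (.inl ?_)] at main2
  · rw [ENNReal.div_le_iff hc0 hct, ENNReal.div_mul_cancel hc0 hct] at main2
    exact main2
  · simp [hM0, hfb]
  · exact ENNReal.rpow_ne_top_of_nonneg hp.le hfb

/-- The Prékopa–Leindler inequality on the line. -/
theorem prekopa_leindler_real {f g h : ℝ → ℝ≥0∞} (hf : Measurable f) (hg : Measurable g)
    (hh : Measurable h) {p q : ℝ} (hp : 0 < p) (hq : 0 < q) (hpq : p + q = 1)
    (H : ∀ x y, f x ^ p * g y ^ q ≤ h (p * x + q * y)) :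
    (∫⁻ x, f x) ^ p * (∫⁻ x, g x) ^ q ≤ ∫⁻ x, h x := by
  have hsup : ∀ k : ℝ → ℝ≥0∞, Measurable k →
      Filter.Tendsto (fun n : ℕ => ∫⁻ x, min (k x) n) Filter.atTop (nhds (∫⁻ x, k x)) := by
    intro k hk
    refine lintegral_tendsto_of_tendsto_of_monotone
      (fun n => (hk.min measurable_const).aemeasurable) (.of_forall fun x m n hmn => ?_)
      (.of_forall fun x => ?_)
    · exact min_le_min le_rfl (by exact_mod_cast hmn)
    · have := (tendsto_const_nhds (x := k x)).min ENNReal.tendsto_nat_nhds_top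
      simpa using this
  have hbd : ∀ (k : ℝ → ℝ≥0∞) (n : ℕ), ⨆ x, min (k x) (n : ℝ≥0∞) ≠ ∞ := fun k n =>
    ((iSup_le fun x => min_le_right _ _).trans_lt (ENNReal.natCast_lt_top n)).ne
  have hn : ∀ n : ℕ, (∫⁻ x, min (f x) n) ^ p * (∫⁻ x, min (g x) n) ^ q ≤ ∫⁻ x, h x := fun n =>
    prekopa_leindler_bounded (hf.min measurable_const) (hg.min measurable_const) hh
      (hbd f n) (hbd g n) hp hq hpq fun x y => le_trans (by gcongr <;> exact min_le_left _ _) (H x y)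
  have hf' := (ENNReal.continuous_rpow_const (y := p)).continuousAt.tendsto.comp (hsup f hf)
  have hg' := (ENNReal.continuous_rpow_const (y := q)).continuousAt.tendsto.comp (hsup g hg)
  -- Multiplication on `ℝ≥0∞` is discontinuous at `(0, ∞)`, so vanishing integrals are set apart
  -- before passing to the limit.
  rcases eq_or_ne (∫⁻ x, f x) 0 with f0 | f0
  · simp [f0, hp]
  rcases eq_or_ne (∫⁻ x, g x) 0 with g0 | g0
  · simp [g0, hq]
  refine le_of_tendsto (ENNReal.Tendsto.mul hf' (.inl ?_) hg' (.inl ?_)) (.of_forall hn)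
  · simp [ENNReal.rpow_eq_zero_iff, f0, hp, hp.not_gt]
  · simp [ENNReal.rpow_eq_zero_iff, g0, hq, hq.not_gt]

/-! ### Prékopa–Leindler in several variables, and product densities. -/

theorem lintegral_fin_succ {n : ℕ} {k : (Fin (n + 1) → ℝ) → ℝ≥0∞} (hk : Measurable k) :
    ∫⁻ x, k x = ∫⁻ s : ℝ, ∫⁻ y : Fin n → ℝ, k (Fin.cons s y) := by
  have hmp := (volume_preserving_piFinSuccAbove (fun _ : Fin (n + 1) => ℝ) 0).symm
  rw [← hmp.lintegral_comp hk, Measure.volume_eq_prod, lintegral_prod]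
  · simp [MeasurableEquiv.piFinSuccAbove_symm_apply, Fin.consEquiv]
  · exact (hk.comp hmp.measurable).aemeasurable

theorem measurable_fin_cons {n : ℕ} :
    Measurable fun z : ℝ × (Fin n → ℝ) => (Fin.cons z.1 z.2 : Fin (n + 1) → ℝ) := by
  refine measurable_pi_lambda _ fun i => ?_
  refine Fin.cases ?_ (fun i => ?_) i
  · simpa using measurable_fst
  · simp only [Fin.cons_succ]; fun_prop

/-- The Prékopa–Leindler inequality. -/
theorem prekopa_leindler {p q : ℝ} (hp : 0 < p) (hq : 0 < q) (hpq : p + q = 1) (n : ℕ)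
    {f g h : (Fin n → ℝ) → ℝ≥0∞} (hf : Measurable f) (hg : Measurable g)
    (hh : Measurable h) (H : ∀ x y, f x ^ p * g y ^ q ≤ h (p • x + q • y)) :
    (∫⁻ x, f x) ^ p * (∫⁻ x, g x) ^ q ≤ ∫⁻ x, h x := by
  induction n with
  | zero =>
    have e : ∀ k : (Fin 0 → ℝ) → ℝ≥0∞, ∫⁻ x, k x = k 0 := by
      intro k
      rw [lintegral_unique]
      simp [volume_pi]
      congr 1
    rw [e, e, e]
    simpa using H 0 0
  | succ n ih =>
    rw [lintegral_fin_succ hf, lintegral_fin_succ hg, lintegral_fin_succ hh]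
    have hm : ∀ k : (Fin (n + 1) → ℝ) → ℝ≥0∞, Measurable k →
        Measurable fun s : ℝ => ∫⁻ y : Fin n → ℝ, k (Fin.cons s y) := fun k hk =>
      (hk.comp measurable_fin_cons).lintegral_prod_right'
    have hc : ∀ (k : (Fin (n + 1) → ℝ) → ℝ≥0∞) (s : ℝ), Measurable k →
        Measurable fun y : Fin n → ℝ => k (Fin.cons s y) := fun k s hk =>
      (hk.comp measurable_fin_cons).comp measurable_prodMk_left
    -- The marginals in the first coordinate satisfy the one-dimensional hypothesis by induction
    -- applied to the slices at `s` and `t`.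
    refine prekopa_leindler_real (hm f hf) (hm g hg) (hm h hh) hp hq hpq fun s t => ?_
    refine ih (hc f s hf) (hc g t hg) (hc h _ hh) fun x y => ?_
    refine (H (Fin.cons s x) (Fin.cons t y)).trans_eq (congrArg h ?_)
    ext i
    refine Fin.cases ?_ (fun i => ?_) i <;> simp

theorem lintegral_fin_prod_eq_prod {n : ℕ} {f : Fin n → ℝ → ℝ≥0∞} (hf : ∀ i, Measurable (f i)) :
    ∫⁻ x : Fin n → ℝ, ∏ i, f i (x i) = ∏ i, ∫⁻ s, f i s := by
  induction n with
  | zero =>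
    simp [volume_pi]
  | succ n ih =>
    rw [lintegral_fin_succ (by fun_prop), Fin.prod_univ_succ, ← ih fun i => hf i.succ,
      ← lintegral_mul_const _ (hf 0)]
    refine lintegral_congr fun s => ?_
    simp only [Fin.prod_univ_succ, Fin.cons_zero, Fin.cons_succ]
    rw [lintegral_const_mul _ (by fun_prop)]

theorem pi_withDensity_eq {n : ℕ} {f : Fin n → ℝ → ℝ≥0∞} (hf : ∀ i, Measurable (f i))
    [∀ i, SigmaFinite (volume.withDensity (f i))] :
    Measure.pi (fun i => volume.withDensity (f i)) =
      (volume : Measure (Fin n → ℝ)).withDensity fun x => ∏ i, f i (x i) := by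
  refine Measure.pi_eq fun s hs => ?_
  rw [withDensity_apply _ (.univ_pi hs), ← lintegral_indicator (.univ_pi hs)]
  have : ∀ i, volume.withDensity (f i) (s i) = ∫⁻ x, (s i).indicator (f i) x := fun i => by
    rw [withDensity_apply _ (hs i), lintegral_indicator (hs i)]
  simp only [this]
  rw [← lintegral_fin_prod_eq_prod fun i => (hf i).indicator (hs i)]
  refine lintegral_congr fun x => ?_
  by_cases hx : x ∈ Set.univ.pi s
  · rw [Set.indicator_of_mem hx]
    exact Finset.prod_congr rfl fun i _ => (Set.indicator_of_mem (hx i trivial) _).symm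
  · rw [Set.indicator_of_notMem hx]
    simp only [Set.mem_pi, Set.mem_univ, true_implies, not_forall] at hx
    obtain ⟨i, hi⟩ := hx
    exact (Finset.prod_eq_zero (Finset.mem_univ i) (Set.indicator_of_notMem hi _)).symm

/-! ### Majorization and the permutohedron. -/

theorem increasingArrangement_monotone {n : ℕ} (x : Fin n → ℝ) :
    Monotone (increasingArrangement x) := Tuple.monotone_sort x

theorem sum_increasingArrangement {n : ℕ} (x : Fin n → ℝ) :
    ∑ i, increasingArrangement x i = ∑ i, x i := Equiv.sum_comp (Tuple.sort x) x

/-- Abel summation: nonnegative partial sums against a nonnegative antitone weight. -/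
theorem sum_mul_nonneg_of_antitone {n : ℕ} {d e : Fin n → ℝ} (hd : Antitone d)
    (hd0 : ∀ i, 0 ≤ d i) (he : ∀ j, 0 ≤ ∑ i ∈ Finset.Iic j, e i) : 0 ≤ ∑ i, d i * e i := by
  induction n with
  | zero => simp
  | succ n ih =>
    -- Subtracting the last weight keeps the others nonnegative and antitone; the amount removed is
    -- that weight times the full sum, handled by `h2`.
    have h1 := ih (d := fun i => d i.castSucc - d (Fin.last n)) (e := fun i => e i.castSucc)
      (fun i j hij => sub_le_sub_right (hd (by simpa using hij)) _)
      (fun i => sub_nonneg.2 (hd (Fin.le_last _))) (fun j => by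
        have := he j.castSucc
        rwa [← Fin.map_castSuccEmb_Iic, Finset.sum_map] at this)
    have h2 := he (Fin.last n)
    rw [show Finset.Iic (Fin.last n) = Finset.univ from Finset.Iic_top, Fin.sum_univ_castSucc] at h2
    rw [Fin.sum_univ_castSucc]
    have h3 := mul_nonneg (hd0 (Fin.last n)) h2
    simp only [sub_mul, Finset.sum_sub_distrib, ← Finset.mul_sum] at h1
    linarith

/-- The convex hull of the rearrangements of `u`. -/
def permutohedron {n : ℕ} (u : Fin n → ℝ) : Set (Fin n → ℝ) :=
  convexHull ℝ (Set.range fun σ : Equiv.Perm (Fin n) => u ∘ σ)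

/-- Otherwise a hyperplane separates the compact hull from the orthant below `w`. Its normal has
nonpositive coefficients, and the rearrangement inequality with Abel summation then contradicts the
separation at one vertex. -/
theorem SupMajorizes.exists_le {n : ℕ} {u w : Fin n → ℝ} (h : SupMajorizes u w) :
    ∃ z ∈ permutohedron u, z ≤ w := by
  by_contra! hcon
  have hdisj : Disjoint (permutohedron u) (Set.Iic w) :=
    Set.disjoint_left.2 fun z hz hzw => hcon z hz hzw
  obtain ⟨f, s, t, hfs, hst, hft⟩ := geometric_hahn_banach_compact_closed
    (convex_convexHull ℝ _) ((Set.finite_range _).isCompact_convexHull ℝ)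
    (convex_Iic w) isClosed_Iic hdisj
  have hf : ∀ x, f x = ∑ i, x i * f (Pi.single i 1) := by
    intro x
    conv_lhs => rw [pi_eq_sum_univ' x]
    simp [map_sum]
  set d : Fin n → ℝ := fun i => - f (Pi.single i 1) with hd
  have hd0 : ∀ i, 0 ≤ d i := by
    intro i
    by_contra! hneg
    have hpos : 0 < f (Pi.single i 1) := by simpa [hd] using hneg
    -- Moving `N` units down coordinate `i` stays in the orthant but would push `f` below `t`.
    obtain ⟨N, hN⟩ := exists_nat_gt ((f w - t) / f (Pi.single i 1))
    have := hft (w - (N : ℝ) • Pi.single i 1) (by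
      simp only [Set.mem_Iic, sub_le_self_iff]
      intro j
      have : (0 : ℝ) ≤ (Pi.single i (1 : ℝ) : Fin n → ℝ) j := by
        by_cases hij : j = i
        · subst hij; simp
        · simp [hij]
      simpa using mul_nonneg N.cast_nonneg this)
    rw [map_sub, map_smul, smul_eq_mul] at this
    rw [div_lt_iff₀ hpos] at hN
    linarith
  -- sort the weight decreasingly and rearrange `u` and `w` increasingly
  let τ : Equiv.Perm (Fin n) := Tuple.sort (-d)
  have hτ : Antitone (d ∘ τ) := by
    have := Tuple.monotone_sort (-d)
    intro i j hij
    simpa using this hij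
  have hu : ∑ i, d (τ i) * increasingArrangement u i = ∑ i, d i * u (Tuple.sort u (τ.symm i)) := by
    rw [← Equiv.sum_comp τ fun i => d i * u (Tuple.sort u (τ.symm i))]
    simp [increasingArrangement]
  have hw : ∑ i, d (τ i) * increasingArrangement w i ≤ ∑ i, d i * w i := by
    have hanti : Antivary (d ∘ τ) (increasingArrangement w) :=
      hτ.antivary (increasingArrangement_monotone w)
    have := hanti.sum_mul_le_sum_mul_comp_perm (σ := τ.trans (Tuple.sort w).symm)
    rw [← Equiv.sum_comp τ (fun i => d i * w i)]
    simpa [increasingArrangement] using this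
  have habel := sum_mul_nonneg_of_antitone hτ (fun i => hd0 _)
    (e := fun i => increasingArrangement w i - increasingArrangement u i) (fun j => by
      rw [Finset.sum_sub_distrib]; exact sub_nonneg.2 (h j))
  simp only [mul_sub, Finset.sum_sub_distrib, Function.comp] at habel
  -- This vertex pairs the smallest entries of `u` with the largest weights `d`.
  have h1 := hfs (u ∘ (τ.symm.trans (Tuple.sort u))) (subset_convexHull ℝ _ ⟨_, rfl⟩)
  have h2 := hft w Set.self_mem_Iic
  rw [hf] at h1 h2
  have e1 : ∑ i, d i * w i = - ∑ i, w i * f (Pi.single i 1) := by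
    simp [hd, mul_comm]
  have e2 : ∑ i, d i * u (Tuple.sort u (τ.symm i)) =
      - ∑ i, (u ∘ (τ.symm.trans (Tuple.sort u))) i * f (Pi.single i 1) := by
    simp [hd, mul_comm]
  linarith

theorem increasingArrangement_eq_of_monotone_comp {n : ℕ} {x : Fin n → ℝ} (σ : Equiv.Perm (Fin n))
    (h : Monotone (x ∘ σ)) : increasingArrangement x = x ∘ σ :=
  (Tuple.comp_sort_eq_comp_iff_monotone.2 h).symm

theorem increasingArrangement_neg {n : ℕ} (x : Fin n → ℝ) (i : Fin n) :
    increasingArrangement (-x) i = - increasingArrangement x (Fin.rev i) := by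
  have : Monotone ((-x) ∘ (Fin.revPerm.trans (Tuple.sort x))) := by
    intro i j hij
    simpa [increasingArrangement] using increasingArrangement_monotone x (Fin.rev_le_rev.2 hij)
  rw [increasingArrangement_eq_of_monotone_comp _ this]
  simp [increasingArrangement]

/-- Negation turns sums of largest entries into minus sums of smallest entries, so one separation
argument serves both weak orders. -/
theorem SubMajorizes.supMajorizes_neg {n : ℕ} {u w : Fin n → ℝ} (h : SubMajorizes u w) :
    SupMajorizes (-u) (-w) := by
  intro j
  have e : ∀ x : Fin n → ℝ, ∑ i ∈ Finset.Iic j, increasingArrangement (-x) i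
      = - ∑ i ∈ Finset.Ici (Fin.rev j), increasingArrangement x i := by
    intro x
    rw [← Fin.map_revPerm_Iic, Finset.sum_map]
    simp [increasingArrangement_neg]
  rw [e, e]
  exact neg_le_neg (h (Fin.rev j))

theorem neg_mem_permutohedron {n : ℕ} {u z : Fin n → ℝ} (h : z ∈ permutohedron (-u)) :
    -z ∈ permutohedron u := by
  have : -z ∈ -permutohedron (-u) := by simpa using h
  rw [permutohedron, ← convexHull_neg] at this
  refine convexHull_mono ?_ this
  rintro _ ⟨σ, hσ⟩
  refine ⟨σ, ?_⟩
  rw [← neg_inj, ← hσ]; rfl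

theorem SubMajorizes.exists_ge {n : ℕ} {u w : Fin n → ℝ} (h : SubMajorizes u w) :
    ∃ z ∈ permutohedron u, w ≤ z := by
  obtain ⟨z, hz, hzw⟩ := h.supMajorizes_neg.exists_le
  exact ⟨-z, neg_mem_permutohedron hz, by simpa using neg_le_neg hzw⟩

theorem sum_eq_of_mem_permutohedron {n : ℕ} {u z : Fin n → ℝ} (h : z ∈ permutohedron u) :
    ∑ i, z i = ∑ i, u i := by
  have hc : Convex ℝ {z : Fin n → ℝ | ∑ i, z i = ∑ i, u i} :=
    convex_hyperplane (f := fun z : Fin n → ℝ => ∑ i, z i)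
      ⟨fun x y => by simp [Finset.sum_add_distrib], fun c x => by simp [Finset.mul_sum]⟩ _
  refine convexHull_min ?_ hc h
  rintro _ ⟨σ, rfl⟩
  exact Equiv.sum_comp σ u

/-- A point of the hull below `w` has the same total as `w`, so it equals `w`. This is the hard half
of Rado's theorem. -/
theorem Majorizes.mem_permutohedron {n : ℕ} {u w : Fin n → ℝ} (h : Majorizes u w) :
    w ∈ permutohedron u := by
  obtain ⟨z, hz, hzw⟩ := SupMajorizes.exists_le h.2
  have hs : ∑ i, z i = ∑ i, w i := by
    rw [sum_eq_of_mem_permutohedron hz, ← sum_increasingArrangement u,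
      ← sum_increasingArrangement w, h.1]
  have : z = w := funext fun i =>
    (Finset.sum_eq_sum_iff_of_le fun i _ => hzw i).1 hs i (Finset.mem_univ i)
  exact this ▸ hz

theorem comp_perm_mem_permutohedron {n : ℕ} {u z : Fin n → ℝ} (h : z ∈ permutohedron u)
    (σ : Equiv.Perm (Fin n)) : z ∘ σ ∈ permutohedron u := by
  let L : (Fin n → ℝ) →ₗ[ℝ] (Fin n → ℝ) := LinearMap.funLeft ℝ ℝ σ
  have : L z ∈ L '' permutohedron u := ⟨z, h, rfl⟩
  rw [permutohedron, L.image_convexHull] at this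
  refine convexHull_mono ?_ this
  rintro _ ⟨_, ⟨τ, rfl⟩, rfl⟩
  exact ⟨σ.trans τ, by ext; simp [L, LinearMap.funLeft_apply]⟩

/-! ### Joint convexity of the product. -/

/-- Contracting all points slightly towards an interior point `c` brings them into the interior;
continuity lets the contraction tend to the identity. One-sided derivatives at endpoints are thereby
avoided. -/
theorem ConvexOn.of_interior {E : Type*} [NormedAddCommGroup E] [NormedSpace ℝ E] {S : Set E}
    {F : E → ℝ} (hS : Convex ℝ S) (hne : (interior S).Nonempty) (hc : ContinuousOn F S)
    (hF : ConvexOn ℝ (interior S) F) : ConvexOn ℝ S F := by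
  obtain ⟨c, hcS⟩ := hne
  refine ⟨hS, fun x hx y hy p q hp hq hpq => ?_⟩
  have hmem : ∀ z ∈ S, ∀ ε ∈ Set.Ioc (0 : ℝ) 1, (1 - ε) • z + ε • c ∈ interior S :=
    fun z hz ε hε => hS.combo_self_interior_mem_interior hz hcS (by linarith [hε.2]) hε.1
      (by ring)
  have hpos : Set.Ioc (0 : ℝ) 1 ∈ nhdsWithin (0 : ℝ) (Set.Ioi 0) :=
    Ioc_mem_nhdsGT one_pos
  have hlim : ∀ z ∈ S, Filter.Tendsto (fun ε : ℝ => F ((1 - ε) • z + ε • c))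
      (nhdsWithin (0 : ℝ) (Set.Ioi 0)) (nhds (F z)) := by
    intro z hz
    refine (hc z hz).tendsto.comp (tendsto_nhdsWithin_iff.2 ⟨?_, ?_⟩)
    · have : Continuous fun ε : ℝ => (1 - ε) • z + ε • c := by fun_prop
      have h0 := this.tendsto 0
      simp only [sub_zero, one_smul, zero_smul, add_zero] at h0
      exact h0.mono_left nhdsWithin_le_nhds
    · filter_upwards [hpos] with ε hε using interior_subset (hmem z hz ε hε)
  refine le_of_tendsto_of_tendsto (hlim _ (hS hx hy hp hq hpq))
    (((hlim x hx).const_smul p).add ((hlim y hy).const_smul q)) ?_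
  filter_upwards [hpos] with ε hε
  have := hF.2 (hmem x hx ε hε) (hmem y hy ε hε) hp hq hpq
  convert this using 2
  obtain rfl : p = 1 - q := by linarith
  module

/-- Completing the square: `A` times the form is `(A p + B q)² + (A C - B²) q²`; if `A = 0` then `B
= 0`. -/
theorem quadratic_form_nonneg {A B C p q : ℝ} (hA : 0 ≤ A) (hC : 0 ≤ C) (h : B ^ 2 ≤ A * C) :
    0 ≤ A * p ^ 2 + 2 * B * p * q + C * q ^ 2 := by
  rcases hA.eq_or_lt with rfl | hA
  · have : B = 0 := by
      have : B ^ 2 = 0 := le_antisymm (by simpa using h) (sq_nonneg B)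
      simpa using this
    subst this
    have := mul_nonneg hC (sq_nonneg q)
    linarith
  · by_contra! hneg
    have h1 := mul_neg_of_pos_of_neg hA hneg
    nlinarith [sq_nonneg (A * p + B * q), mul_nonneg (sub_nonneg.2 h) (sq_nonneg q)]

theorem iteratedDerivWithin_two_of_mem_interior {f : ℝ → ℝ} {I : Set ℝ} {u : ℝ}
    (hu : u ∈ interior I) : iteratedDerivWithin 2 f I u = deriv (deriv f) u := by
  have h1 : iteratedDerivWithin 2 f I u = derivWithin (iteratedDerivWithin 1 f I) I u :=
    congrFun iteratedDerivWithin_succ u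
  have h2 : iteratedDerivWithin 1 f I =ᶠ[nhds u] deriv f := by
    filter_upwards [isOpen_interior.mem_nhds hu] with v hv
    rw [iteratedDerivWithin_one, derivWithin_of_mem_nhds (mem_interior_iff_mem_nhds.1 hv)]
  rw [h1, derivWithin_of_mem_nhds (mem_interior_iff_mem_nhds.1 hu), h2.deriv_eq]

theorem ContDiffOn.hasDerivAt_of_mem_interior {f : ℝ → ℝ} {I : Set ℝ} (hf : ContDiffOn ℝ 2 f I)
    {u : ℝ} (hu : u ∈ interior I) : HasDerivAt f (deriv f u) u :=
  ((hf.contDiffAt (mem_interior_iff_mem_nhds.1 hu)).differentiableAt (by norm_num)).hasDerivAt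

theorem ContDiffOn.contDiffOn_deriv_interior {f : ℝ → ℝ} {I : Set ℝ} (hf : ContDiffOn ℝ 2 f I) :
    ContDiffOn ℝ 1 (deriv f) (interior I) :=
  (hf.mono interior_subset).deriv_of_isOpen isOpen_interior (by norm_num)

theorem ContDiffOn.hasDerivAt_deriv_of_mem_interior {f : ℝ → ℝ} {I : Set ℝ}
    (hf : ContDiffOn ℝ 2 f I) {u : ℝ} (hu : u ∈ interior I) :
    HasDerivAt (deriv f) (deriv (deriv f) u) u :=
  ((hf.contDiffOn_deriv_interior.contDiffAt (isOpen_interior.mem_nhds hu)).differentiableAt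
    (by norm_num)).hasDerivAt

theorem ContDiffOn.continuousOn_deriv_deriv_interior {f : ℝ → ℝ} {I : Set ℝ}
    (hf : ContDiffOn ℝ 2 f I) : ContinuousOn (deriv (deriv f)) (interior I) :=
  hf.contDiffOn_deriv_interior.continuousOn_deriv_of_isOpen isOpen_interior (by norm_num)

theorem exists_deriv_ne_zero {f : ℝ → ℝ} {I : Set ℝ} (hI : I.OrdConnected)
    (hI' : (interior I).Nonempty) (hf : ContDiffOn ℝ 2 f I) (hinj : Set.InjOn f I) :
    ∃ u ∈ interior I, deriv f u ≠ 0 := by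
  by_contra! h
  obtain ⟨a, ha⟩ := hI'
  obtain ⟨ε, hε, hball⟩ := Metric.isOpen_iff.1 isOpen_interior a ha
  have hb : a + ε / 2 ∈ interior I := hball (by simp [abs_of_pos hε, hε])
  have heq : f a = f (a + ε / 2) :=
    isOpen_interior.is_const_of_deriv_eq_zero hI.convex.interior.isPreconnected
      (fun u hu => (hf.hasDerivAt_of_mem_interior hu).differentiableAt.differentiableWithinAt)
      (fun u hu => h u hu) ha hb
  have := hinj (interior_subset ha) (interior_subset hb) heq
  linarith

/-- The Hessian of `φ(u) ψ(v)` has diagonal `φ''ψ`, `φψ''` and off-diagonal `φ'ψ'`, so the assumed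
inequality is exactly nonnegativity of its determinant. What remains is `ψ'' ≥ 0`, which has to be
deduced. -/
theorem convexOn_mul_of_deriv {I J : Set ℝ} (hI : I.OrdConnected) (hI' : (interior I).Nonempty)
    (hJ : J.OrdConnected) (hJ' : (interior J).Nonempty) {φ ψ : ℝ → ℝ}
    (hφ_nonneg : ∀ u ∈ I, 0 ≤ φ u) (hψ_nonneg : ∀ v ∈ J, 0 ≤ ψ v)
    (hφ : ContDiffOn ℝ 2 φ I) (hψ : ContDiffOn ℝ 2 ψ J) (hφ_inj : Set.InjOn φ I)
    (hφ_convex : ∀ u ∈ I, 0 ≤ iteratedDerivWithin 2 φ I u)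
    (hφψ : ∀ u ∈ I, ∀ v ∈ J,
      (derivWithin φ I u * derivWithin ψ J v) ^ 2 ≤
        iteratedDerivWithin 2 φ I u * iteratedDerivWithin 2 ψ J v * φ u * ψ v) :
    ConvexOn ℝ (I ×ˢ J) fun z : ℝ × ℝ => φ z.1 * ψ z.2 := by
  have h1 : ∀ u ∈ interior I, 0 ≤ deriv (deriv φ) u := fun u hu => by
    rw [← iteratedDerivWithin_two_of_mem_interior hu]; exact hφ_convex u (interior_subset hu)
  have h2 : ∀ u ∈ interior I, ∀ v ∈ interior J, (deriv φ u * deriv ψ v) ^ 2 ≤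
      deriv (deriv φ) u * deriv (deriv ψ) v * φ u * ψ v := by
    intro u hu v hv
    have := hφψ u (interior_subset hu) v (interior_subset hv)
    rwa [iteratedDerivWithin_two_of_mem_interior hu, iteratedDerivWithin_two_of_mem_interior hv,
      derivWithin_of_mem_nhds (mem_interior_iff_mem_nhds.1 hu),
      derivWithin_of_mem_nhds (mem_interior_iff_mem_nhds.1 hv)] at this
  obtain ⟨u₀, hu₀, hu₀'⟩ := exists_deriv_ne_zero hI hI' hφ hφ_inj
  have h3 : ∀ v ∈ interior J, deriv (deriv ψ) v < 0 → deriv ψ v = 0 := by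
    intro v hv hneg
    by_contra hne
    have hpos : 0 < (deriv φ u₀ * deriv ψ v) ^ 2 := by positivity
    have := h2 u₀ hu₀ v hv
    have h4 : 0 ≤ deriv (deriv φ) u₀ * φ u₀ * ψ v :=
      mul_nonneg (mul_nonneg (h1 u₀ hu₀) (hφ_nonneg _ (interior_subset hu₀)))
        (hψ_nonneg _ (interior_subset hv))
    have h5 := mul_nonpos_of_nonpos_of_nonneg hneg.le h4
    linarith
  -- If `ψ'' < 0` at `v`, then also near `v` by continuity, so `ψ'` vanishes near `v` by `h3`,
  -- forcing `ψ''(v) = 0`.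
  have h6 : ∀ v ∈ interior J, 0 ≤ deriv (deriv ψ) v := by
    intro v hv
    by_contra! hneg
    have hev : ∀ᶠ w in nhds v, deriv (deriv ψ) w < 0 ∧ w ∈ interior J :=
      ((hψ.continuousOn_deriv_deriv_interior.continuousAt
        (isOpen_interior.mem_nhds hv)).eventually_lt continuousAt_const hneg).and
        (isOpen_interior.mem_nhds hv)
    have : deriv ψ =ᶠ[nhds v] fun _ => 0 := by
      filter_upwards [hev] with w hw using h3 w hw.2 hw.1
    rw [this.deriv_eq] at hneg
    simp at hneg
  refine ConvexOn.of_interior (hI.convex.prod hJ.convex) ?_ ?_ ?_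
  · rw [interior_prod_eq]; exact hI'.prod hJ'
  · exact (hφ.continuousOn.comp continuousOn_fst fun z hz => hz.1).mul
      (hψ.continuousOn.comp continuousOn_snd fun z hz => hz.2)
  rw [interior_prod_eq]
  refine ⟨hI.convex.interior.prod hJ.convex.interior, ?_⟩
  rintro ⟨u, v⟩ ⟨hu, hv⟩ ⟨u', v'⟩ ⟨hu', hv'⟩ p q hp hq hpq
  simp only at hu hv hu' hv'
  -- Convexity is tested along the segment, where the second derivative is the Hessian form in the
  -- direction `(u' - u, v' - v)`.
  let U : ℝ → ℝ := fun t => u + t * (u' - u)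
  let V : ℝ → ℝ := fun t => v + t * (v' - v)
  have hU : ∀ t ∈ Set.Icc (0 : ℝ) 1, U t ∈ interior I := fun t ht => by
    have := hI.convex.interior hu hu' (sub_nonneg.2 ht.2) ht.1 (by ring)
    convert this using 1
    simp only [U, smul_eq_mul]; ring
  have hV : ∀ t ∈ Set.Icc (0 : ℝ) 1, V t ∈ interior J := fun t ht => by
    have := hJ.convex.interior hv hv' (sub_nonneg.2 ht.2) ht.1 (by ring)
    convert this using 1
    simp only [V, smul_eq_mul]; ring
  have hUd : ∀ t, HasDerivAt U (u' - u) t := fun t => by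
    have := ((hasDerivAt_id t).mul_const (u' - u)).const_add u
    rw [one_mul] at this
    exact this
  have hVd : ∀ t, HasDerivAt V (v' - v) t := fun t => by
    have := ((hasDerivAt_id t).mul_const (v' - v)).const_add v
    rw [one_mul] at this
    exact this
  have hφU : ∀ t ∈ Set.Icc (0 : ℝ) 1, HasDerivAt (fun t => φ (U t)) (deriv φ (U t) * (u' - u)) t :=
    fun t ht => (hφ.hasDerivAt_of_mem_interior (hU t ht)).comp t (hUd t)
  have hψV : ∀ t ∈ Set.Icc (0 : ℝ) 1, HasDerivAt (fun t => ψ (V t)) (deriv ψ (V t) * (v' - v)) t :=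
    fun t ht => (hψ.hasDerivAt_of_mem_interior (hV t ht)).comp t (hVd t)
  have hφU' : ∀ t ∈ Set.Icc (0 : ℝ) 1,
      HasDerivAt (fun t => deriv φ (U t)) (deriv (deriv φ) (U t) * (u' - u)) t :=
    fun t ht => (hφ.hasDerivAt_deriv_of_mem_interior (hU t ht)).comp t (hUd t)
  have hψV' : ∀ t ∈ Set.Icc (0 : ℝ) 1,
      HasDerivAt (fun t => deriv ψ (V t)) (deriv (deriv ψ) (V t) * (v' - v)) t :=
    fun t ht => (hψ.hasDerivAt_deriv_of_mem_interior (hV t ht)).comp t (hVd t)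
  have hconv : ConvexOn ℝ (Set.Icc (0 : ℝ) 1) fun t => φ (U t) * ψ (V t) := by
    refine convexOn_of_hasDerivWithinAt2_nonneg (convex_Icc 0 1)
      (fun t ht => ((hφU t ht).mul (hψV t ht)).continuousAt.continuousWithinAt)
      (fun t ht => ((hφU t (interior_subset ht)).mul (hψV t (interior_subset ht))).hasDerivWithinAt)
      (fun t ht => ((((hφU' t (interior_subset ht)).mul_const _).mul
        (hψV t (interior_subset ht))).add ((hφU t (interior_subset ht)).mul
        ((hψV' t (interior_subset ht)).mul_const _))).hasDerivWithinAt) ?_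
    intro t ht
    have hUt := hU t (interior_subset ht)
    have hVt := hV t (interior_subset ht)
    have := quadratic_form_nonneg (A := deriv (deriv φ) (U t) * ψ (V t))
      (B := deriv φ (U t) * deriv ψ (V t)) (C := φ (U t) * deriv (deriv ψ) (V t))
      (p := u' - u) (q := v' - v) (mul_nonneg (h1 _ hUt) (hψ_nonneg _ (interior_subset hVt)))
      (mul_nonneg (hφ_nonneg _ (interior_subset hUt)) (h6 _ hVt))
      ((h2 _ hUt _ hVt).trans_eq (by ring))
    linarith
  have := hconv.2 (x := 0) (by simp) (y := 1) (by simp) hp hq hpq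
  simp only [smul_eq_mul, mul_zero, mul_one, zero_add, U, V, zero_mul, add_zero, one_mul,
    add_sub_cancel] at this
  obtain rfl : p = 1 - q := by linarith
  have e1 : (1 - q) * u + q * u' = u + q * (u' - u) := by ring
  have e2 : (1 - q) * v + q * v' = v + q * (v' - v) := by ring
  simpa only [Prod.smul_mk, Prod.mk_add_mk, smul_eq_mul, e1, e2] using this

/-! ### Exchange argument for the likelihood ratio order. -/

theorem sum_mul_sub_sum_mul_swap {ι : Type*} [Fintype ι] [DecidableEq ι] (a b : ι → ℝ) {i j : ι}
    (hij : i ≠ j) :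
    ∑ k, a k * b k - ∑ k, a k * b (Equiv.swap i j k) = (a i - a j) * (b i - b j) := by
  rw [← Finset.sum_sub_distrib, Fintype.sum_eq_add i j hij]
  · simp; ring
  · intro k hk
    simp [Equiv.swap_apply_of_ne_of_ne hk.1 hk.2]

/-- If exchanging an adjacent increasing pair never increases `G`, the decreasing arrangement
minimises `G` among all rearrangements. -/
theorem antitone_le_comp_perm {α : Type*} [Preorder α] {n : ℕ} (G : (Fin n → ℝ) → α) {c : Fin n → ℝ}
    (hc : Antitone c)
    (hG : ∀ σ : Equiv.Perm (Fin n), ∀ i j : Fin n, (i : ℕ) + 1 = j → c (σ i) ≤ c (σ j) →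
      G (c ∘ σ ∘ Equiv.swap i j) ≤ G (c ∘ σ))
    (σ : Equiv.Perm (Fin n)) : G c ≤ G (c ∘ σ) := by
  classical
  -- The sum `-∑ k c(π k)` measures sortedness: swapping an adjacent strict ascent raises it and
  -- does not raise `G`, so a maximiser is antitone.
  obtain ⟨π, hπ, hmax⟩ := Finset.exists_max_image
    (Finset.univ.filter fun π : Equiv.Perm (Fin n) => G (c ∘ π) ≤ G (c ∘ σ))
    (fun π => ∑ k : Fin n, -((k : ℕ) : ℝ) * c (π k)) ⟨σ, by simp⟩
  simp only [Finset.mem_filter, Finset.mem_univ, true_and] at hπ hmax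
  have hadj : ∀ i j : Fin n, (i : ℕ) + 1 = j → c (π j) ≤ c (π i) := by
    intro i j hij
    by_contra! hlt
    have h1 := hmax ((Equiv.swap i j).trans π) ((hG π i j hij hlt.le).trans hπ)
    have hne : i ≠ j := by rintro rfl; omega
    have h2 := sum_mul_sub_sum_mul_swap (fun k : Fin n => -((k : ℕ) : ℝ)) (fun k => c (π k)) hne
    have h3 : ((j : ℕ) : ℝ) = (i : ℕ) + 1 := by exact_mod_cast hij.symm
    simp only [Equiv.trans_apply] at h1
    rw [h3] at h2
    linarith
  have hanti : Antitone (c ∘ π) := by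
    cases n with
    | zero => exact Subsingleton.antitone _
    | succ n => exact Fin.antitone_iff_succ_le.2 fun i => hadj _ _ (by simp)
  have heq : c ∘ π = c := by
    have := Tuple.unique_monotone (f := -c) (σ := π) (τ := 1)
      (fun i j hij => neg_le_neg (hanti hij)) (fun i j hij => neg_le_neg (hc hij))
    funext i
    simpa using congrFun this i
  rwa [heq] at hπ

theorem measurePreserving_comp_perm {n : ℕ} (σ : Equiv.Perm (Fin n)) :
    MeasurePreserving (fun x : Fin n → ℝ => x ∘ σ) := by
  have := volume_measurePreserving_piCongrLeft (fun _ : Fin n => ℝ) σ.symm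
  have heq : (fun x : Fin n → ℝ => x ∘ σ) =
      MeasurableEquiv.piCongrLeft (fun _ : Fin n => ℝ) σ.symm := by
    funext x i
    have := Equiv.piCongrLeft_apply_apply (fun _ : Fin n => ℝ) σ.symm x (σ i)
    rw [Equiv.symm_apply_apply] at this
    exact this.symm
  rwa [heq]

theorem measurableSet_sum_mul_le {n : ℕ} (c : Fin n → ℝ) (t : ℝ) :
    MeasurableSet {x : Fin n → ℝ | ∑ k, c k * x k ≤ t} :=
  measurableSet_le (by fun_prop) measurable_const

/-- Compare each `x` having `x j ≤ x i` with its swap: `x` has the larger density and the smaller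
weighted sum. So if just one of the two lies in `S`, it is the heavier one. -/
theorem withDensity_prod_swap_le {n : ℕ} {f : Fin n → ℝ → ℝ≥0∞} (hf : ∀ k, Measurable (f k))
    {i j : Fin n} (hij : i ≠ j) (hlr : ∀ x y, y < x → f i y * f j x ≤ f i x * f j y)
    {c : Fin n → ℝ} (hc : c i ≤ c j) (t : ℝ) :
    (volume.withDensity fun x : Fin n → ℝ => ∏ k, f k (x k))
        {x | ∑ k, (c ∘ Equiv.swap i j) k * x k ≤ t} ≤
      (volume.withDensity fun x : Fin n → ℝ => ∏ k, f k (x k)) {x | ∑ k, c k * x k ≤ t} := by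
  set s := Equiv.swap i j with hs
  set S := {x : Fin n → ℝ | ∑ k, c k * x k ≤ t} with hS
  set W : (Fin n → ℝ) → ℝ≥0∞ := fun x => ∏ k, f k (x k) with hW
  have hSm : MeasurableSet S := measurableSet_sum_mul_le c t
  have hWm : Measurable W := by fun_prop
  have hsm := measurePreserving_comp_perm s
  have hss : ∀ x : Fin n → ℝ, (x ∘ s) ∘ s = x := fun x => by ext k; simp [hs]
  have hS' : {x : Fin n → ℝ | ∑ k, (c ∘ s) k * x k ≤ t} = (fun x => x ∘ s) ⁻¹' S := by
    ext x
    simp only [Set.mem_ofPred_eq, Set.mem_preimage, hS]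
    rw [← Equiv.sum_comp s]
    simp [hs]
  rw [hS', withDensity_apply _ (hsm.measurable hSm), withDensity_apply _ hSm,
    ← lintegral_indicator (hsm.measurable hSm), ← lintegral_indicator hSm]
  have hWs : ∀ x, x j ≤ x i → W (x ∘ s) ≤ W x := by
    intro x hx
    have hfac : ∀ y : Fin n → ℝ, W y = f i (y i) * f j (y j) *
        ∏ k ∈ (Finset.univ.erase i).erase j, f k (y k) := by
      intro y
      rw [mul_assoc, Finset.mul_prod_erase _ (fun k => f k (y k)) (by simp [hij.symm]),
        Finset.mul_prod_erase _ (fun k => f k (y k)) (by simp)]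
    rw [hfac, hfac]
    have h1 : ∏ k ∈ (Finset.univ.erase i).erase j, f k ((x ∘ s) k) =
        ∏ k ∈ (Finset.univ.erase i).erase j, f k (x k) := by
      refine Finset.prod_congr rfl fun k hk => ?_
      simp only [Finset.mem_erase, Finset.mem_univ, and_true] at hk
      simp [hs, Equiv.swap_apply_of_ne_of_ne hk.2 hk.1]
    rw [h1]
    gcongr ?_ * _
    simp only [Function.comp, hs, Equiv.swap_apply_left, Equiv.swap_apply_right]
    rcases hx.eq_or_lt with h | h
    · rw [h]
    · exact hlr _ _ h
  have hSs : ∀ x, x j ≤ x i → x ∘ s ∈ S → x ∈ S := by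
    intro x hx hxs
    have h1 := sum_mul_sub_sum_mul_swap c x hij
    have h2 : (c i - c j) * (x i - x j) ≤ 0 :=
      mul_nonpos_of_nonpos_of_nonneg (by linarith) (by linarith)
    simp only [hS, Set.mem_ofPred_eq, Function.comp, hs] at hxs ⊢
    linarith
  -- The swap preserves Lebesgue measure, so the integrals may be compared orbit by orbit.
  have hsymm : ∀ k : (Fin n → ℝ) → ℝ≥0∞, Measurable k → 2 * ∫⁻ x, k x = ∫⁻ x, (k x + k (x ∘ s)) := by
    intro k hk
    rw [lintegral_add_left hk, hsm.lintegral_comp hk, two_mul]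
  have hmain : ∀ x, x j ≤ x i →
      ((fun x => x ∘ s) ⁻¹' S).indicator W x + ((fun x => x ∘ s) ⁻¹' S).indicator W (x ∘ s) ≤
        S.indicator W x + S.indicator W (x ∘ s) := by
    intro x hx
    have h1 := hWs x hx
    have h2 := hSs x hx
    simp only [Set.indicator, Set.mem_preimage, hss]
    by_cases hxS : x ∈ S
    · by_cases hxsS : x ∘ s ∈ S
      · simp [hxS, hxsS]
      · simpa [hxS, hxsS] using h1
    · have hxsS : x ∘ s ∉ S := fun h => hxS (h2 h)
      simp [hxS, hxsS]
  have : 2 * ∫⁻ x, ((fun x => x ∘ s) ⁻¹' S).indicator W x ≤ 2 * ∫⁻ x, S.indicator W x := by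
    rw [hsymm _ (hWm.indicator (hsm.measurable hSm)), hsymm _ (hWm.indicator hSm)]
    refine lintegral_mono fun x => ?_
    rcases le_total (x j) (x i) with h | h
    · exact hmain x h
    · have := hmain (x ∘ s) (by simpa [hs] using h)
      rw [hss] at this
      rw [add_comm, add_comm (S.indicator W x)]
      exact this
  exact (ENNReal.mul_le_mul_iff_right (by simp) (by simp)).1 this

/-- Cross-multiplying removes the exceptional `0 / 0` points. A ratio equal to `∞` at `y` would stay
`∞` at `x`, which is impossible when `f x ≠ 0`. -/
theorem LikelihoodRatioLE.exists_cross_mul_le {Ω : Type*} [MeasurableSpace Ω] {μ : Measure Ω}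
    {X Y : Ω → ℝ} (h : LikelihoodRatioLE X Y μ) :
    ∃ f g : ℝ → ℝ≥0, IsDensityOf f X μ ∧ IsDensityOf g Y μ ∧
      ∀ x y, y < x → (g y : ℝ≥0∞) * f x ≤ g x * f y := by
  obtain ⟨f, g, hf, hg, hmono⟩ := h
  refine ⟨f, g, hf, hg, fun x y hyx => ?_⟩
  rcases eq_or_ne (g y) 0 with h1 | h1
  · simp [h1]
  rcases eq_or_ne (f x) 0 with h2 | h2
  · simp [h2]
  have h3 := hmono (a := y) (b := x) (by simp [h1]) (by simp [h2]) hyx.le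
  simp only at h3
  have h2' : (f x : ℝ≥0∞) ≠ 0 := by simpa using h2
  have h4 : f y ≠ 0 := by
    intro h4
    rw [h4, ENNReal.coe_zero, ENNReal.div_zero (by simpa using h1), top_le_iff] at h3
    exact ENNReal.div_ne_top ENNReal.coe_ne_top h2' h3
  have h4' : (f y : ℝ≥0∞) ≠ 0 := by simpa using h4
  rw [ENNReal.div_le_iff h4' ENNReal.coe_ne_top] at h3
  calc (g y : ℝ≥0∞) * f x ≤ (g x / f x * f y) * f x := by gcongr
    _ = g x * f y := by
      rw [mul_right_comm, ENNReal.div_mul_cancel h2' ENNReal.coe_ne_top]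

theorem map_fun_eq_withDensity {Ω : Type*} [MeasurableSpace Ω] {μ : Measure Ω}
    [IsProbabilityMeasure μ] {n : ℕ} {X : Fin n → Ω → ℝ} (hX : iIndepFun X μ)
    {f : Fin n → ℝ → ℝ≥0} (hf : ∀ k, IsDensityOf (f k) (X k) μ) :
    μ.map (fun ω k => X k ω) =
      (volume : Measure (Fin n → ℝ)).withDensity fun x => ∏ k, (f k (x k) : ℝ≥0∞) := by
  rw [(iIndepFun_iff_map_fun_eq_pi_map fun k => (hf k).1).1 hX]
  simp only [(hf _).2.2]
  exact pi_withDensity_eq fun k => (hf k).2.1.coe_nnreal_ennreal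

theorem measure_sum_mul_swap_le {Ω : Type*} [MeasurableSpace Ω] {μ : Measure Ω}
    [IsProbabilityMeasure μ] {n : ℕ} {X : Fin n → Ω → ℝ} (hX_meas : ∀ i, Measurable (X i))
    (hX : iIndepFun X μ)
    (hX_lr : ∀ i j : Fin n, (i : ℕ) + 1 = (j : ℕ) → LikelihoodRatioLE (X j) (X i) μ)
    {i j : Fin n} (hij : (i : ℕ) + 1 = j) {c : Fin n → ℝ} (hc : c i ≤ c j) (t : ℝ) :
    μ {ω | ∑ k, (c ∘ Equiv.swap i j) k * X k ω ≤ t} ≤ μ {ω | ∑ k, c k * X k ω ≤ t} := by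
  have hne : i ≠ j := by rintro rfl; omega
  have hdens : ∀ k, ∃ f : ℝ → ℝ≥0, IsDensityOf f (X k) μ := by
    intro k
    by_cases hk : (k : ℕ) + 1 < n
    · obtain ⟨-, g, -, hg, -⟩ := hX_lr k ⟨k + 1, hk⟩ rfl
      exact ⟨g, hg⟩
    -- The last index has a predecessor, because `i` and `j` are two distinct indices.
    · obtain ⟨f, -, hf, -, -⟩ := hX_lr ⟨k - 1, by omega⟩ k (by simp; omega)
      exact ⟨f, hf⟩
  choose d hd using hdens
  obtain ⟨fj, fi, hfj, hfi, hlr⟩ := (hX_lr i j hij).exists_cross_mul_le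
  -- Different likelihood ratio relations may come with different versions of a density; those at
  -- `i` and `j` must be the versions satisfying `hlr` pointwise.
  let f : Fin n → ℝ → ℝ≥0 := Function.update (Function.update d i fi) j fj
  have hfi' : f i = fi := by simp [f, hne]
  have hfj' : f j = fj := by simp [f]
  have hf : ∀ k, IsDensityOf (f k) (X k) μ := by
    intro k
    by_cases h1 : k = j
    · subst h1; rwa [hfj']
    by_cases h2 : k = i
    · subst h2; rwa [hfi']
    · simpa [f, h1, h2] using hd k
  have hmeas : Measurable fun ω k => X k ω := measurable_pi_lambda _ hX_meas
  have hlaw : ∀ c : Fin n → ℝ, μ {ω | ∑ k, c k * X k ω ≤ t} =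
      ((volume : Measure (Fin n → ℝ)).withDensity fun x => ∏ k, (f k (x k) : ℝ≥0∞))
        {x | ∑ k, c k * x k ≤ t} := fun c => by
    rw [← map_fun_eq_withDensity hX hf, Measure.map_apply hmeas (measurableSet_sum_mul_le c t)]
    rfl
  rw [hlaw, hlaw]
  exact withDensity_prod_swap_le (f := fun k x => (f k x : ℝ≥0∞))
    (fun k => (hf k).2.1.coe_nnreal_ennreal) hne (by simpa only [hfi', hfj'] using hlr) hc t

/-! ### Quasi-concavity of the distribution function in the parameters. -/

theorem IsLogConcaveOn.coe_rpow_mul_le {f : ℝ → ℝ≥0}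
    (hf : IsLogConcaveOn Set.univ fun x => (f x : ℝ)) {p q : ℝ} (hp : 0 < p) (hq : 0 < q)
    (hpq : p + q = 1) (x y : ℝ) :
    (f x : ℝ≥0∞) ^ p * (f y : ℝ≥0∞) ^ q ≤ f (p * x + q * y) := by
  have h := hf.2 x trivial y trivial p ⟨hp.le, by linarith⟩
  obtain rfl : q = 1 - p := by linarith
  rw [← ENNReal.coe_rpow_of_nonneg _ hp.le, ← ENNReal.coe_rpow_of_nonneg _ hq.le]
  exact_mod_cast h

section Law

variable {Ω : Type*} [MeasurableSpace Ω] {μ : Measure Ω} [IsProbabilityMeasure μ] {n : ℕ}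
  {X : Fin n → Ω → ℝ} {J : Set ℝ} {ψ : ℝ → ℝ}

/-- The joint law of the `X i` is the coordinatewise image under `ψ` of the product of the laws of
`ψ⁻¹(X i)`; independence is needed only for the `X i` themselves. -/
theorem measure_sum_mul_le_eq_lintegral
    (hX_meas : ∀ i, Measurable (X i)) (hX : iIndepFun X μ)
    (hJ : J.OrdConnected) (hψ : ContinuousOn ψ J) (hX_range : ∀ i, ∀ᵐ ω ∂μ, X i ω ∈ ψ '' J)
    {f : Fin n → ℝ → ℝ≥0}
    (hf : ∀ i, IsDensityOf (f i) (fun ω => Function.invFunOn ψ J (X i ω)) μ)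
    (c : Fin n → ℝ) (t : ℝ) :
    MeasurableSet {v : Fin n → ℝ | (∀ i, v i ∈ J) ∧ ∑ i, c i * ψ (v i) ≤ t} ∧
    μ {ω | ∑ i, c i * X i ω ≤ t} =
      ∫⁻ v, {v : Fin n → ℝ | (∀ i, v i ∈ J) ∧ ∑ i, c i * ψ (v i) ≤ t}.indicator
        (fun v => ∏ i, (f i (v i) : ℝ≥0∞)) v := by
  classical
  set V : Fin n → Ω → ℝ := fun i ω => Function.invFunOn ψ J (X i ω) with hV
  have hJm : MeasurableSet J := hJ.measurableSet
  -- Extending `ψ` by 0 off `J` gives a globally measurable map; the value there is irrelevant, as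
  -- the laws live on `J`.
  set ψ' : ℝ → ℝ := J.piecewise ψ 0 with hψ'
  have hψ'm : Measurable ψ' := hψ.measurable_piecewise continuousOn_const hJm
  have hψ'J : ∀ v ∈ J, ψ' v = ψ v := fun v hv => Set.piecewise_eq_of_mem _ _ _ hv
  set K := {v : Fin n → ℝ | (∀ i, v i ∈ J) ∧ ∑ i, c i * ψ (v i) ≤ t} with hK
  have hKeq : K = {v : Fin n → ℝ | ∀ i, v i ∈ J} ∩ {v | ∑ i, c i * ψ' (v i) ≤ t} := by
    ext v
    simp only [hK, Set.mem_inter_iff, Set.mem_ofPred_eq]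
    refine and_congr_right fun hv => ?_
    simp only [hψ'J _ (hv _)]
  have hKm : MeasurableSet K := by
    rw [hKeq]
    refine MeasurableSet.inter ?_ (measurableSet_le (by fun_prop) measurable_const)
    have : {v : Fin n → ℝ | ∀ i, v i ∈ J} = ⋂ i, (fun v => v i) ⁻¹' J := by ext; simp
    rw [this]
    exact MeasurableSet.iInter fun i => hJm.preimage (measurable_pi_apply i)
  refine ⟨hKm, ?_⟩
  have hVX : ∀ i, ∀ᵐ ω ∂μ, V i ω ∈ J ∧ ψ' (V i ω) = X i ω := by
    intro i
    filter_upwards [hX_range i] with ω hω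
    have h1 := Function.invFunOn_mem hω
    exact ⟨h1, by rw [hψ'J _ h1]; exact Function.invFunOn_eq hω⟩
  have hlaw : ∀ i, μ.map (X i) = (μ.map (V i)).map ψ' := by
    intro i
    rw [AEMeasurable.map_map_of_aemeasurable hψ'm.aemeasurable (hf i).1]
    exact Measure.map_congr ((hVX i).mono fun ω h => h.2.symm)
  have : ∀ i, IsProbabilityMeasure (μ.map (V i)) := fun i =>
    Measure.isProbabilityMeasure_map (hf i).1
  have hprob : ∀ i, IsProbabilityMeasure ((μ.map (V i)).map ψ') := fun i =>
    Measure.isProbabilityMeasure_map hψ'm.aemeasurable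
  have hpiV : Measure.pi (fun i => μ.map (V i)) =
      (volume : Measure (Fin n → ℝ)).withDensity fun x => ∏ k, (f k (x k) : ℝ≥0∞) := by
    have hs : ∀ i, SigmaFinite (volume.withDensity fun x => (f i x : ℝ≥0∞)) := fun i => by
      rw [← (hf i).2.2]; infer_instance
    rw [← pi_withDensity_eq fun k => (hf k).2.1.coe_nnreal_ennreal]
    congr 1
    funext i
    exact (hf i).2.2
  have hmeasX : Measurable fun ω k => X k ω := measurable_pi_lambda _ hX_meas
  have hmap : Measurable fun (v : Fin n → ℝ) i => ψ' (v i) :=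
    measurable_pi_lambda _ fun i => hψ'm.comp (measurable_pi_apply i)
  have hae : ∀ᵐ v ∂Measure.pi (fun i => μ.map (V i)), ∀ i, v i ∈ J := by
    rw [ae_all_iff]
    intro i
    have h1 : ∀ᵐ x ∂μ.map (V i), x ∈ J :=
      (ae_map_iff (hf i).1 hJm).2 ((hVX i).mono fun ω h => h.1)
    exact Measure.tendsto_eval_ae_ae.eventually h1
  calc μ {ω | ∑ i, c i * X i ω ≤ t}
      = μ.map (fun ω k => X k ω) {x | ∑ i, c i * x i ≤ t} := by
        rw [Measure.map_apply hmeasX (measurableSet_sum_mul_le c t)]; rfl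
    _ = (Measure.pi fun i => μ.map (V i)) {v | ∑ i, c i * ψ' (v i) ≤ t} := by
        rw [(iIndepFun_iff_map_fun_eq_pi_map fun k => (hX_meas k).aemeasurable).1 hX]
        simp only [hlaw]
        rw [← Measure.pi_map_pi fun i => hψ'm.aemeasurable,
          Measure.map_apply hmap (measurableSet_sum_mul_le c t)]
        rfl
    _ = (Measure.pi fun i => μ.map (V i)) K := by
        refine measure_congr ?_
        filter_upwards [hae] with v hv
        rw [hKeq]
        exact propext ⟨fun h => ⟨hv, h⟩, fun h => h.2⟩
    _ = _ := by
        rw [hpiV, withDensity_apply _ hKm, lintegral_indicator hKm]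

/-- Prékopa–Leindler bounds the probability at `p • u + q • w` below by the weighted geometric mean
of those at `u` and `w`, hence by `r`. -/
theorem convex_setOf_le_measure_sum_mul_le {I : Set ℝ} {φ : ℝ → ℝ}
    (hX_meas : ∀ i, Measurable (X i)) (hX : iIndepFun X μ) (hI : I.OrdConnected)
    (hJ : J.OrdConnected) (hψ : ContinuousOn ψ J) (hX_range : ∀ i, ∀ᵐ ω ∂μ, X i ω ∈ ψ '' J)
    (hX_logconcave : ∀ i, HasLogConcaveDensity (fun ω => Function.invFunOn ψ J (X i ω)) μ)
    (hconv : ConvexOn ℝ (I ×ˢ J) fun z : ℝ × ℝ => φ z.1 * ψ z.2) (t : ℝ) (r : ℝ≥0∞) :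
    Convex ℝ {u : Fin n → ℝ | (∀ i, u i ∈ I) ∧ r ≤ μ {ω | ∑ i, φ (u i) * X i ω ≤ t}} := by
  choose f hf hlog using hX_logconcave
  rw [convex_iff_forall_pos]
  rintro u ⟨hu, hur⟩ w ⟨hw, hwr⟩ p q hp hq hpq
  refine ⟨fun i => hI.convex (hu i) (hw i) hp.le hq.le hpq, ?_⟩
  have hlaw := measure_sum_mul_le_eq_lintegral hX_meas hX hJ hψ hX_range hf
  set W : (Fin n → ℝ) → ℝ≥0∞ := fun v => ∏ i, (f i (v i) : ℝ≥0∞) with hW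
  have hWm : Measurable W := Finset.measurable_prod _ fun i _ =>
    (hf i).2.1.coe_nnreal_ennreal.comp (measurable_pi_apply i)
  have hpl := prekopa_leindler hp hq hpq n
    (hWm.indicator (hlaw (fun i => φ (u i)) t).1) (hWm.indicator (hlaw (fun i => φ (w i)) t).1)
    (hWm.indicator (hlaw (fun i => φ ((p • u + q • w) i)) t).1) (by
      intro x y
      by_cases hx : x ∈ {v : Fin n → ℝ | (∀ i, v i ∈ J) ∧ ∑ i, φ (u i) * ψ (v i) ≤ t}
      swap
      · rw [Set.indicator_of_notMem hx, ENNReal.zero_rpow_of_pos hp, zero_mul]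
        exact zero_le
      by_cases hy : y ∈ {v : Fin n → ℝ | (∀ i, v i ∈ J) ∧ ∑ i, φ (w i) * ψ (v i) ≤ t}
      swap
      · rw [Set.indicator_of_notMem hy, ENNReal.zero_rpow_of_pos hq, mul_zero]
        exact zero_le
      -- Joint convexity enters here: `u, x` and `w, y` are mixed with the same weights.
      have hxy : p • x + q • y ∈ {v : Fin n → ℝ | (∀ i, v i ∈ J) ∧
          ∑ i, φ ((p • u + q • w) i) * ψ (v i) ≤ t} := by
        refine ⟨fun i => hJ.convex (hx.1 i) (hy.1 i) hp.le hq.le hpq, ?_⟩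
        calc ∑ i, φ ((p • u + q • w) i) * ψ ((p • x + q • y) i)
            ≤ ∑ i, (p * (φ (u i) * ψ (x i)) + q * (φ (w i) * ψ (y i))) :=
              Finset.sum_le_sum fun i _ => hconv.2 (x := (u i, x i)) ⟨hu i, hx.1 i⟩
                (y := (w i, y i)) ⟨hw i, hy.1 i⟩ hp.le hq.le hpq
          _ = p * ∑ i, φ (u i) * ψ (x i) + q * ∑ i, φ (w i) * ψ (y i) := by
              rw [Finset.sum_add_distrib, Finset.mul_sum, Finset.mul_sum]
          _ ≤ p * t + q * t := by
              gcongr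
              · exact hx.2
              · exact hy.2
          _ = t := by rw [← add_mul, hpq, one_mul]
      rw [Set.indicator_of_mem hx, Set.indicator_of_mem hy, Set.indicator_of_mem hxy]
      simp only [hW]
      rw [← ENNReal.prod_rpow_of_nonneg hp.le, ← ENNReal.prod_rpow_of_nonneg hq.le,
        ← Finset.prod_mul_distrib]
      exact Finset.prod_le_prod' fun i _ => (hlog i).coe_rpow_mul_le hp hq hpq (x i) (y i))
  rw [← (hlaw _ t).2, ← (hlaw _ t).2, ← (hlaw _ t).2] at hpl
  refine le_trans ?_ hpl
  have hr : r ≠ ∞ := (hur.trans_lt (measure_lt_top _ _)).ne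
  calc r = r ^ p * r ^ q := by
        rw [← ENNReal.rpow_add_of_nonneg _ _ hp.le hq.le, hpq, ENNReal.rpow_one]
    _ ≤ _ := by gcongr

end Law

/-! ### The stochastic comparison. -/

/-- If the coefficient vectors are, up to order, the images under `φ` of `u` and `w`, and `w` is
comparable with a point of the permutohedron of `u` on which the coefficients are larger, then the
decreasing arrangements of the coefficients give stochastically ordered sums. -/
theorem stochasticLE_of_mem_permutohedron {Ω : Type*} [MeasurableSpace Ω] {μ : Measure Ω}
    [IsProbabilityMeasure μ] {n : ℕ} {X : Fin n → Ω → ℝ}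
    (hX_meas : ∀ i, Measurable (X i)) (hX_nonneg : ∀ i, ∀ᵐ ω ∂μ, 0 ≤ X i ω) (hX : iIndepFun X μ)
    (hX_lr : ∀ i j : Fin n, (i : ℕ) + 1 = (j : ℕ) → LikelihoodRatioLE (X j) (X i) μ)
    {I : Set ℝ} {φ : ℝ → ℝ}
    (hconv : ∀ (t : ℝ) (r : ℝ≥0∞),
      Convex ℝ {u : Fin n → ℝ | (∀ i, u i ∈ I) ∧ r ≤ μ {ω | ∑ i, φ (u i) * X i ω ≤ t}})
    {a b : Fin n → ℝ} (ha : ∀ i, a i ∈ φ '' I)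
    {z : Fin n → ℝ} (hz : z ∈ permutohedron fun i => Function.invFunOn φ I (a i))
    (hzb : (∀ i, z i ∈ I) → ∀ i, b i ≤ φ (z i)) :
    StochasticLE (fun ω => ∑ i, increasingArrangement b (Fin.rev i) * X i ω)
      (fun ω => ∑ i, increasingArrangement a (Fin.rev i) * X i ω) μ := by
  intro t
  set u : Fin n → ℝ := fun i => Function.invFunOn φ I (a i) with hu
  have huI : ∀ i, u i ∈ I := fun i => Function.invFunOn_mem (ha i)
  have hua : ∀ i, φ (u i) = a i := fun i => Function.invFunOn_eq (ha i)
  let πa : Equiv.Perm (Fin n) := Fin.revPerm.trans (Tuple.sort a)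
  let πb : Equiv.Perm (Fin n) := Fin.revPerm.trans (Tuple.sort b)
  have hanti : Antitone (a ∘ πa) := fun i j hij =>
    increasingArrangement_monotone a (Fin.rev_le_rev.2 hij)
  -- The level is the probability for decreasing `a`. Each vertex attains it by the exchange
  -- argument, and convexity extends this to the hull.
  have hsub : permutohedron u ⊆ {u : Fin n → ℝ | (∀ i, u i ∈ I) ∧
      μ {ω | ∑ i, (a ∘ πa) i * X i ω ≤ t} ≤ μ {ω | ∑ i, φ (u i) * X i ω ≤ t}} := by
    refine convexHull_min ?_ (hconv t _)
    rintro _ ⟨σ, rfl⟩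
    refine ⟨fun i => huI _, ?_⟩
    simp only [Function.comp, hua]
    have := antitone_le_comp_perm (fun c => μ {ω | ∑ i, c i * X i ω ≤ t}) hanti
      (fun τ i j hij hc => measure_sum_mul_swap_le hX_meas hX hX_lr (c := (a ∘ πa) ∘ τ) hij hc t)
      (σ.trans πa.symm)
    simpa [Function.comp] using this
  -- Reordering `z` by `πb` aligns it with the decreasing arrangement of `b`; `φ ∘ z ∘ πb` itself
  -- need not be sorted.
  have hmem := hsub (comp_perm_mem_permutohedron hz πb)
  have hzI : ∀ i, z i ∈ I := fun i => by simpa using hmem.1 (πb.symm i)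
  refine hmem.2.trans (measure_mono_ae ?_)
  filter_upwards [ae_all_iff.2 hX_nonneg] with ω hω h
  exact (Finset.sum_le_sum fun i _ =>
    mul_le_mul_of_nonneg_right (hzb hzI (πb i)) (hω i)).trans h

theorem theorem4p1 {Ω : Type*} [MeasurableSpace Ω] (μ : Measure Ω) [IsProbabilityMeasure μ]
    (n : ℕ) (X : Fin n → Ω → ℝ)
    (hX_meas : ∀ i, Measurable (X i))
    (hX_nonneg : ∀ i, ∀ᵐ ω ∂μ, 0 ≤ X i ω)
    (hX_indep : iIndepFun X μ)
    -- X_1 ≥_lr X_2 ≥_lr ... ≥_lr X_n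
    (hX_lr : ∀ i j : Fin n, (i : ℕ) + 1 = (j : ℕ) → LikelihoodRatioLE (X j) (X i) μ)
    -- the domains of φ and ψ: intervals such as [0, ∞), (0, ∞) or ℝ
    (I J : Set ℝ) (hI : I.OrdConnected) (hI' : (interior I).Nonempty)
    (hJ : J.OrdConnected) (hJ' : (interior J).Nonempty)
    (φ ψ : ℝ → ℝ)
    (hφ_nonneg : ∀ u ∈ I, 0 ≤ φ u) (hψ_nonneg : ∀ v ∈ J, 0 ≤ ψ v)
    (hφ_smooth : ContDiffOn ℝ 2 φ I) (hψ_smooth : ContDiffOn ℝ 2 ψ J)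
    (hφ_mono : StrictMonoOn φ I ∨ StrictAntiOn φ I)
    (hψ_mono : StrictMonoOn ψ J ∨ StrictAntiOn ψ J)
    (hφ_convex : ∀ u ∈ I, 0 ≤ iteratedDerivWithin 2 φ I u)
    (hφψ : ∀ u ∈ I, ∀ v ∈ J,
      (derivWithin φ I u * derivWithin ψ J v) ^ 2 ≤
        iteratedDerivWithin 2 φ I u * iteratedDerivWithin 2 ψ J v * φ u * ψ v)
    -- ψ⁻¹(X_i) is defined almost surely and has a log-concave density
    (hX_range : ∀ i, ∀ᵐ ω ∂μ, X i ω ∈ ψ '' J)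
    (hX_logconcave : ∀ i, HasLogConcaveDensity (fun ω => Function.invFunOn ψ J (X i ω)) μ)
    (a b : Fin n → ℝ) (ha : ∀ i, a i ∈ φ '' I) (hb : ∀ i, b i ∈ φ '' I) :
    (Majorizes (fun i => Function.invFunOn φ I (a i)) (fun i => Function.invFunOn φ I (b i)) →
      StochasticLE (fun ω => ∑ i, increasingArrangement b (Fin.rev i) * X i ω)
        (fun ω => ∑ i, increasingArrangement a (Fin.rev i) * X i ω) μ) ∧
    (StrictMonoOn φ I →
      SubMajorizes (fun i => Function.invFunOn φ I (a i))
        (fun i => Function.invFunOn φ I (b i)) →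
      StochasticLE (fun ω => ∑ i, increasingArrangement b (Fin.rev i) * X i ω)
        (fun ω => ∑ i, increasingArrangement a (Fin.rev i) * X i ω) μ) ∧
    (StrictAntiOn φ I →
      SupMajorizes (fun i => Function.invFunOn φ I (a i))
        (fun i => Function.invFunOn φ I (b i)) →
      StochasticLE (fun ω => ∑ i, increasingArrangement b (Fin.rev i) * X i ω)
        (fun ω => ∑ i, increasingArrangement a (Fin.rev i) * X i ω) μ) := by
  have hφ_inj : Set.InjOn φ I := hφ_mono.elim StrictMonoOn.injOn StrictAntiOn.injOn
  have hconv := fun t r => convex_setOf_le_measure_sum_mul_le hX_meas hX_indep hI hJ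
    hψ_smooth.continuousOn hX_range hX_logconcave (convexOn_mul_of_deriv hI hI' hJ hJ' hφ_nonneg
      hψ_nonneg hφ_smooth hψ_smooth hφ_inj hφ_convex hφψ) t r
  have hwI : ∀ i, Function.invFunOn φ I (b i) ∈ I := fun i => Function.invFunOn_mem (hb i)
  have hwb : ∀ i, φ (Function.invFunOn φ I (b i)) = b i := fun i => Function.invFunOn_eq (hb i)
  have key := fun (z : Fin n → ℝ) (hz : z ∈ permutohedron fun i => Function.invFunOn φ I (a i)) =>
    stochasticLE_of_mem_permutohedron hX_meas hX_nonneg hX_indep hX_lr hconv (b := b) ha hz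
  -- Under majorization `φ⁻¹(b)` is itself the hull point. In the weak cases the hull point lies on
  -- the side of `φ⁻¹(b)` where `φ` is larger.
  refine ⟨fun h => key _ h.mem_permutohedron fun _ i => (hwb i).ge, fun hφ h => ?_, fun hφ h => ?_⟩
  · obtain ⟨z, hz, hwz⟩ := h.exists_ge
    refine key z hz fun hzI i => ?_
    rw [← hwb i]
    exact hφ.monotoneOn (hwI i) (hzI i) (hwz i)
  · obtain ⟨z, hz, hzw⟩ := h.exists_le
    refine key z hz fun hzI i => ?_
    rw [← hwb i]
    exact hφ.antitoneOn (hzI i) (hwI i) (hzw i)
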